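/- Let $a>0$ and $b>0$ be constants, let $a_1,b_1:[0,\infty)\to\mathbb R$ be Lebesgue measurable and essentially bounded, and let $g,h:[0,\infty)\to\mathbb R$ be Lebesgue measurable with $g(t)\le t$, $h(t)\le t$ for all $t\ge 0$ and $\limsup_{t\to\infty}(t-g(t))<\infty$, $\limsup_{t\to\infty}(t-h(t))<\infty$. Consider the equation $$\ddot x(t)+a\,\dot x(t)+b\,x(t)+a_1(t)\,\dot x(g(t))+b_1(t)\,x(h(t))=0. \qquad (2)$$ For $t_0\ge 0$, real numbers $x_0,x_0'$ and bounded Borel measurable functions $\varphi,\psi:(-\infty,t_0)\to\mathbb R$, a solution of (2) with the initial data $x(t)=\varphi(t)$, $\dot x(t)=\psi(t)$ for $t<t_0$, $x(t_0)=x_0$, $\dot x(t_0)=x_0'$ is a function $x:\mathbb R\to\mathbb R$ which takes these initial data, whose derivative $\dot x$ on $[t_0,\infty)$ is locally absolutely continuous, and which satisfies (2) for almost every $t\ge t_0$; here $\dot x(s)$ is read as $\psi(s)$ for $s<t_0$. Equation (2) is called (uniformly) exponentially stable if there are $M>0$ and $\mu>0$ such that for all $t_0\ge 0$ and all such data $\varphi,\psi,x_0,x_0'$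 the solution satisfies $$|x(t)|\le M e^{-\mu(t-t_0)}\Big[|x(t_0)|+|\dot x(t_0)|+\sup_{s<t_0}\big(|\varphi(s)|+|\psi(s)|\big)\Big],\qquad t\ge t_0 .$$ Suppose that for some $t_0\ge 0$, with $\|\cdot\|$ denoting the norm of $L_\infty[t_0,\infty)$, one of the following conditions holds: 1) $a^2>4b$ and $\displaystyle \frac{2a}{\sqrt{a^2-4b}\,\bigl(a-\sqrt{a^2-4b}\bigr)}\|a_1\|+\frac1b\|b_1\|<1$; 2) $a^2<4b$ and $\displaystyle \frac{2\bigl(a+\sqrt{4b-a^2}\bigr)}{a\sqrt{4b-a^2}}\|a_1\|+\frac{4}{a\sqrt{4b-a^2}}\|b_1\|<1$; 3) $a^2=4b$ and $\displaystyle \frac{2}{\sqrt b}\|a_1\|+\frac1b\|b_1\|<1$. Then equation (2) is exponentially stable. -/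

import Mathlib

open MeasureTheory Set Filter
open scoped ENNReal

/-- A delayed argument `g : [0, ∞) → ℝ`: Lebesgue measurable, `g t ≤ t`, and
`limsup_{t → ∞} (t - g t) < ∞` (the delay `t - g t` is eventually bounded above).
Only the values of `g` on `[0, ∞)` matter. -/
structure IsDelayedArgument (g : ℝ → ℝ) : Prop where
  aemeasurable : AEMeasurable g (volume.restrict (Ici 0))
  le_self : ∀ t, 0 ≤ t → g t ≤ t
  bounded_delay : IsBoundedUnder (· ≤ ·) atTop (fun t => t - g t)

/-- An initial function on `(-∞, t₀)`: Borel measurable and bounded.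
Only the values of `φ` on `(-∞, t₀)` matter. -/
structure IsInitialFunction (t₀ : ℝ) (φ : ℝ → ℝ) : Prop where
  measurable : Measurable (fun s : Iio t₀ => φ s)
  bounded : ∃ C : ℝ, ∀ t, t < t₀ → |φ t| ≤ C

/-- `x`, together with its derivative `v = ẋ`, is a solution of the initial value problem
`ẍ(t) + a(t) ẋ(t) + b(t) x(t) + a₁(t) ẋ(g(t)) + b₁(t) x(h(t)) = 0` for `t ≥ t₀`,
`x(t) = φ(t)`, `ẋ(t) = ψ(t)` for `t < t₀`, `x(t₀) = x₀`, `ẋ(t₀) = x₀'`.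

As usual for such problems `φ` and `ψ` are independent data: on `(-∞, t₀)` the symbol `ẋ` means
`ψ`, which need not be the derivative of `φ`. On `[t₀, ∞)` the function `v` is the derivative of
`x` (one-sided at `t₀`), it is locally absolutely continuous there, and the equation holds for
almost every `t ≥ t₀`. -/
structure IsSolution (a b a₁ b₁ g h : ℝ → ℝ) (t₀ : ℝ) (φ ψ : ℝ → ℝ) (x₀ x₀' : ℝ)
    (x v : ℝ → ℝ) : Prop where
  history : ∀ t, t < t₀ → x t = φ t
  history_deriv : ∀ t, t < t₀ → v t = ψ t
  initial : x t₀ = x₀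
  initial_deriv : v t₀ = x₀'
  hasDeriv : ∀ t, t₀ ≤ t → HasDerivWithinAt x (v t) (Ici t₀) t
  locally_ac : ∀ T, t₀ ≤ T → AbsolutelyContinuousOnInterval v t₀ T
  equation : ∀ᵐ t ∂(volume.restrict (Ici t₀)), DifferentiableAt ℝ v t ∧
    deriv v t + a t * v t + b t * x t + a₁ t * v (g t) + b₁ t * x (h t) = 0

/-- (Uniform) exponential stability of
`ẍ(t) + a(t) ẋ(t) + b(t) x(t) + a₁(t) ẋ(g(t)) + b₁(t) x(h(t)) = 0`: the constants `M` and `μ`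
serve all initial points `t₀ ≥ 0`, all initial functions and all initial values. -/
def ExponentiallyStable (a b a₁ b₁ g h : ℝ → ℝ) : Prop :=
  ∃ M μ : ℝ, 0 < M ∧ 0 < μ ∧
    ∀ t₀ : ℝ, 0 ≤ t₀ → ∀ φ ψ : ℝ → ℝ, IsInitialFunction t₀ φ → IsInitialFunction t₀ ψ →
      ∀ (x₀ x₀' : ℝ) (x v : ℝ → ℝ), IsSolution a b a₁ b₁ g h t₀ φ ψ x₀ x₀' x v →
        ∀ t, t₀ ≤ t →
          |x t| ≤ M * Real.exp (-μ * (t - t₀)) *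
            (|x₀| + |x₀'| + ⨆ s : Iio t₀, (|φ s| + |ψ s|))

/-! The delayed terms are treated as an input `f` to the autonomous equation `x'' + a x' + b x = f`,
and everything is measured with the weight `exp (-μ (t - s))`. The autonomous equation has gains `α
μ`, `β μ` from `f` to `x'` and `x`. They come from first order equations: a factorization for real
roots (`weightedGain_real_roots`), a rotating frame for complex ones (`weightedGain_complex_roots`).
A delay of at most `δ` costs a factor `exp (μ δ)`, so the loop is a contraction when `exp (μ δ) * (α
μ * A + β μ * B) < 1` (`WeightedGain.abs_le`). The hypotheses imply this at `μ = 0` with strict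
inequality, and continuity carries it to some `μ > 0`.

The contraction works only after a time `T` beyond which the delays are bounded and the norms over
`[t₀, ∞)` apply. Before `T` a crude growth bound (`IsTrajectory.abs_le_exp`) loses only a constant,
because that stretch has length at most `T`. -/

/-! ### First order estimates -/

/-- A differentiable function whose derivative is continuous on `[s, t]` is absolutely continuous
there. -/
theorem absolutelyContinuousOnInterval_of_hasDerivWithinAt {x v : ℝ → ℝ} {s t : ℝ} (hst : s ≤ t)
    (hx : ∀ r ∈ Icc s t, HasDerivWithinAt x (v r) (Icc s t) r) (hv : ContinuousOn v (Icc s t)) :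
    AbsolutelyContinuousOnInterval x s t := by
  obtain ⟨C, hC⟩ := isCompact_Icc.exists_bound_of_continuousOn hv
  have hL : LipschitzOnWith C.toNNReal x (Icc s t) := by
    refine (convex_Icc s t).lipschitzOnWith_of_nnnorm_hasDerivWithin_le hx fun r hr => ?_
    rw [← NNReal.coe_le_coe, coe_nnnorm]
    exact (hC r hr).trans (Real.le_coe_toNNReal C)
  rw [← uIcc_of_le hst] at hL
  exact hL.absolutelyContinuousOnInterval

theorem absolutelyContinuousOnInterval_of_hasDerivAt {x v : ℝ → ℝ} (s t : ℝ) (hst : s ≤ t)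
    (hx : ∀ r, HasDerivAt x (v r) r) (hv : Continuous v) :
    AbsolutelyContinuousOnInterval x s t :=
  absolutelyContinuousOnInterval_of_hasDerivWithinAt hst
    (fun r _ => (hx r).hasDerivWithinAt) hv.continuousOn

theorem integral_exp_mul_sub {κ : ℝ} (hκ : κ ≠ 0) (F s t : ℝ) :
    ∫ r in s..t, F * Real.exp (κ * (r - s)) = F / κ * (Real.exp (κ * (t - s)) - 1) := by
  have h : ∀ r ∈ uIcc s t, HasDerivAt (fun r => F / κ * Real.exp (κ * (r - s)))
      (F * Real.exp (κ * (r - s))) r := fun r _ => by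
    have h1 : HasDerivAt (fun r => κ * (r - s)) κ r := by
      simpa using ((hasDerivAt_id r).sub_const s).const_mul κ
    have h2 := h1.exp.const_mul (F / κ)
    rwa [mul_comm (Real.exp _) κ, ← mul_assoc, div_mul_cancel₀ _ hκ] at h2
  rw [intervalIntegral.integral_eq_sub_of_hasDerivAt h
    (Continuous.intervalIntegrable (by fun_prop) _ _)]
  simp; ring

/-- Growth of an absolutely continuous function with an exponentially bounded derivative. -/
theorem AbsolutelyContinuousOnInterval.abs_le_of_abs_deriv_le {P : ℝ → ℝ} {s t κ F : ℝ}
    (hP : AbsolutelyContinuousOnInterval P s t) (hst : s ≤ t) (hκ : 0 < κ) (hF : 0 ≤ F)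
    (hd : ∀ᵐ r, r ∈ Icc s t → |deriv P r| ≤ F * Real.exp (κ * (r - s))) :
    |P t| ≤ |P s| + F / κ * Real.exp (κ * (t - s)) := by
  have h1 : |∫ r in s..t, deriv P r| ≤ ∫ r in s..t, F * Real.exp (κ * (r - s)) := by
    rw [← Real.norm_eq_abs]
    refine intervalIntegral.norm_integral_le_of_norm_le hst ?_
      (Continuous.intervalIntegrable (by fun_prop) _ _)
    filter_upwards [hd] with r hr hrm
    exact hr (Ioc_subset_Icc_self hrm)
  rw [hP.integral_deriv_eq_sub, integral_exp_mul_sub hκ.ne'] at h1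
  have h2 : 0 ≤ F / κ := by positivity
  have h3 := abs_sub_abs_le_abs_sub (P t) (P s)
  nlinarith

/-- The weighted estimate for `y' + k y = f` with `|f r| ≤ F exp (-μ (r - s))`. -/
theorem abs_le_of_first_order {y y' : ℝ → ℝ} {s t k μ N F : ℝ}
    (hy : AbsolutelyContinuousOnInterval y s t) (hst : s ≤ t) (hk : μ < k) (hF : 0 ≤ F)
    (hd : ∀ᵐ r, r ∈ Icc s t → HasDerivAt y (y' r) r ∧
      |y' r + k * y r| ≤ F * Real.exp (-μ * (r - s)))
    (hN : |y s| ≤ N) :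
    |y t| ≤ (N + F / (k - μ)) * Real.exp (-μ * (t - s)) := by
  have hκ : 0 < k - μ := by linarith
  have he : ∀ r, HasDerivAt (fun r => Real.exp (k * (r - s)))
      (Real.exp (k * (r - s)) * k) r := fun r => by
    have h1 : HasDerivAt (fun r => k * (r - s)) k r := by
      simpa using ((hasDerivAt_id r).sub_const s).const_mul k
    exact h1.exp
  -- With the integrating factor, the derivative is at most `F * exp ((k - μ) (r - s))`; integrating
  -- it gives `F / (k - μ)`.
  have hP : AbsolutelyContinuousOnInterval (fun r => Real.exp (k * (r - s)) * y r) s t :=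
    (absolutelyContinuousOnInterval_of_hasDerivAt s t hst he (by fun_prop)).fun_mul hy
  have h := hP.abs_le_of_abs_deriv_le hst hκ hF (by
    filter_upwards [hd] with r hr hrm
    obtain ⟨h1, h2⟩ := hr hrm
    rw [((he r).fun_mul h1).deriv]
    have : Real.exp (k * (r - s)) * k * y r + Real.exp (k * (r - s)) * y' r
        = Real.exp (k * (r - s)) * (y' r + k * y r) := by ring
    rw [this, abs_mul, Real.abs_exp]
    calc _ ≤ Real.exp (k * (r - s)) * (F * Real.exp (-μ * (r - s))) := by gcongr
      _ = F * (Real.exp (k * (r - s)) * Real.exp (-μ * (r - s))) := by ring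
      _ = _ := by rw [← Real.exp_add]; ring_nf)
  simp only [sub_self, mul_zero, Real.exp_zero, one_mul, abs_mul, Real.abs_exp] at h
  have e1 : Real.exp ((k - μ) * (t - s)) = Real.exp (k * (t - s)) * Real.exp (-μ * (t - s)) := by
    rw [← Real.exp_add]; ring_nf
  have e2 : 1 ≤ Real.exp ((k - μ) * (t - s)) :=
    Real.one_le_exp (mul_nonneg hκ.le (by linarith))
  have h0 : 0 ≤ |y s| := abs_nonneg _
  have h3 : Real.exp (k * (t - s)) * |y t| ≤
      Real.exp (k * (t - s)) * ((N + F / (k - μ)) * Real.exp (-μ * (t - s))) := by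
    calc _ ≤ N * Real.exp ((k - μ) * (t - s)) + F / (k - μ) * Real.exp ((k - μ) * (t - s)) := by
          nlinarith
      _ = _ := by rw [e1]; ring
  exact le_of_mul_le_mul_left h3 (Real.exp_pos _)

/-! ### Trajectories -/

/-- `x` is a primitive of the absolutely continuous function `v` on `[s, t]`, and `w` is almost
everywhere the derivative of `v`. -/
structure IsTrajectory (x v w : ℝ → ℝ) (s t : ℝ) : Prop where
  le : s ≤ t
  hasDeriv : ∀ r ∈ Icc s t, HasDerivWithinAt x (v r) (Icc s t) r
  ac : AbsolutelyContinuousOnInterval v s t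
  hasDerivAt_ae : ∀ᵐ r, r ∈ Icc s t → HasDerivAt v (w r) r

namespace IsTrajectory

variable {x v w : ℝ → ℝ} {s t : ℝ}

theorem mono (H : IsTrajectory x v w s t) {s' t' : ℝ} (hs : s ≤ s') (hst : s' ≤ t') (ht : t' ≤ t) :
    IsTrajectory x v w s' t' where
  le := hst
  hasDeriv r hr := (H.hasDeriv r (Icc_subset_Icc hs ht hr)).mono (Icc_subset_Icc hs ht)
  ac := H.ac.mono (by
    rw [uIcc_of_le hst, uIcc_of_le H.le]; exact Icc_subset_Icc hs ht)
  hasDerivAt_ae := by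
    filter_upwards [H.hasDerivAt_ae] with r hr hrm using hr (Icc_subset_Icc hs ht hrm)

theorem continuousOn_deriv (H : IsTrajectory x v w s t) : ContinuousOn v (Icc s t) := by
  simpa [uIcc_of_le H.le] using H.ac.continuousOn

theorem continuousOn (H : IsTrajectory x v w s t) : ContinuousOn x (Icc s t) :=
  fun r hr => (H.hasDeriv r hr).continuousWithinAt

theorem ac_position (H : IsTrajectory x v w s t) : AbsolutelyContinuousOnInterval x s t :=
  absolutelyContinuousOnInterval_of_hasDerivWithinAt H.le H.hasDeriv H.continuousOn_deriv

theorem hasDerivAt_position_ae (H : IsTrajectory x v w s t) :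
    ∀ᵐ r, r ∈ Icc s t → HasDerivAt x (v r) r := by
  have h1 : ∀ᵐ r : ℝ, r ≠ s := by simp [ae_iff, measure_singleton]
  have h2 : ∀ᵐ r : ℝ, r ≠ t := by simp [ae_iff, measure_singleton]
  filter_upwards [h1, h2] with r hs ht hr
  exact (H.hasDeriv r hr).hasDerivAt
    (Icc_mem_nhds (lt_of_le_of_ne hr.1 hs.symm) (lt_of_le_of_ne hr.2 ht))

end IsTrajectory

/-! ### Gains of the autonomous equation -/

/-- Weighted input-to-state bounds for `x'' + a x' + b x = f`: an input bounded by
`F exp (-μ (r - s))` contributes at most `α F exp (-μ (t - s))` to the derivative and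
`β F exp (-μ (t - s))` to the solution. -/
def WeightedGain (a b μ α β C : ℝ) : Prop :=
  ∀ (s t N F : ℝ) (x v w : ℝ → ℝ), 0 ≤ F → IsTrajectory x v w s t → |x s| ≤ N → |v s| ≤ N →
    (∀ᵐ r, r ∈ Icc s t → |w r + a * v r + b * x r| ≤ F * Real.exp (-μ * (r - s))) →
    |v t| ≤ (C * N + α * F) * Real.exp (-μ * (t - s)) ∧
    |x t| ≤ (C * N + β * F) * Real.exp (-μ * (t - s))

/-- The operator factors: `y = x' + k₂ x` satisfies `y' + k₁ y = f`, so two first order estimates in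
succession bound `y` and then `x`. The gain for the derivative comes from `x' = y - k₂ x`. -/
theorem weightedGain_real_roots {k₁ k₂ μ : ℝ} (hk₂ : 0 < k₂) (h₁ : μ < k₁) (h₂ : μ < k₂) :
    ∃ C, 0 ≤ C ∧ WeightedGain (k₁ + k₂) (k₁ * k₂) μ
      (1 / (k₁ - μ) + k₂ * (1 / ((k₁ - μ) * (k₂ - μ)))) (1 / ((k₁ - μ) * (k₂ - μ))) C := by
  have p₁ : 0 < k₁ - μ := by linarith
  have p₂ : 0 < k₂ - μ := by linarith
  have hCx : 0 ≤ 1 + (1 + k₂) / (k₂ - μ) := by positivity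
  -- `1 + k₂` bounds the initial value of `y`. With `D = 1 + (1 + k₂) / (k₂ - μ)`, the product
  -- dominates both `D`, needed for `x`, and `1 + k₂ + k₂ D`, needed for `v`.
  refine ⟨(1 + k₂) * (1 + (1 + (1 + k₂) / (k₂ - μ))), by positivity, ?_⟩
  intro s t N F x v w hF H hx hv hf
  have hN : 0 ≤ N := (abs_nonneg _).trans hx
  have hy : ∀ r ∈ Icc s t, |v r + k₂ * x r| ≤
      ((1 + k₂) * N + F / (k₁ - μ)) * Real.exp (-μ * (r - s)) := by
    intro r hr
    have H' := H.mono le_rfl hr.1 hr.2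
    refine abs_le_of_first_order (y := fun r => v r + k₂ * x r) (y' := fun r => w r + k₂ * v r)
      (H'.ac.fun_add (H'.ac_position.const_mul k₂)) hr.1 h₁ hF ?_ ?_
    · filter_upwards [hf, H'.hasDerivAt_ae, H'.hasDerivAt_position_ae] with q h1 h2 h3 hq
      refine ⟨(h2 hq).fun_add ((h3 hq).const_mul k₂), ?_⟩
      convert h1 (Icc_subset_Icc le_rfl hr.2 hq) using 2
      ring
    · calc |v s + k₂ * x s| ≤ |v s| + |k₂ * x s| := abs_add_le _ _
        _ = |v s| + k₂ * |x s| := by rw [abs_mul, abs_of_pos hk₂]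
        _ ≤ N + k₂ * N := by gcongr
        _ = _ := by ring
  have hX := abs_le_of_first_order (y := x) (y' := v) H.ac_position H.le h₂
    (F := (1 + k₂) * N + F / (k₁ - μ)) (by positivity) (by
      filter_upwards [H.hasDerivAt_position_ae] with r hr hrm
      exact ⟨hr hrm, hy r hrm⟩) hx
  have hY := hy t ⟨H.le, le_rfl⟩
  set E := Real.exp (-μ * (t - s)) with hE
  have hE0 : 0 < E := Real.exp_pos _
  have e1 : N + ((1 + k₂) * N + F / (k₁ - μ)) / (k₂ - μ) =
      (1 + (1 + k₂) / (k₂ - μ)) * N + 1 / ((k₁ - μ) * (k₂ - μ)) * F := by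
    field_simp
    ring
  rw [e1] at hX
  have e2 : F / (k₁ - μ) = 1 / (k₁ - μ) * F := by ring
  rw [e2] at hY
  generalize 1 + (1 + k₂) / (k₂ - μ) = D at *
  generalize 1 / ((k₁ - μ) * (k₂ - μ)) = β at *
  generalize 1 / (k₁ - μ) = γ at *
  have hNE : 0 ≤ N * E := by positivity
  constructor
  · have : |v t| ≤ |v t + k₂ * x t| + k₂ * |x t| := by
      calc |v t| = |(v t + k₂ * x t) - k₂ * x t| := by ring_nf
        _ ≤ |v t + k₂ * x t| + |k₂ * x t| := abs_sub _ _
        _ = _ := by rw [abs_mul, abs_of_pos hk₂]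
    calc |v t| ≤ ((1 + k₂) * N + γ * F) * E + k₂ * ((D * N + β * F) * E) := by
          refine this.trans (add_le_add hY (mul_le_mul_of_nonneg_left hX hk₂.le))
      _ = ((1 + k₂ + k₂ * D) * N + (γ + k₂ * β) * F) * E := by ring
      _ ≤ _ := by gcongr; nlinarith
  · refine hX.trans ?_
    gcongr
    nlinarith

/-- The vector `(x' + c x, ω x)` rotates with angular speed `ω`, contracts at rate `c`, and is
forced by `(f, 0)`. Its projection on a unit vector rotating along with it therefore solves `y' + c
y = cos(·) f`, a first order equation. -/
theorem weightedGain_complex_roots {c ω μ : ℝ} (hc : 0 < c) (hω : 0 < ω) (hμ : μ < c) :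
    ∃ C, 0 ≤ C ∧ WeightedGain (2 * c) (c ^ 2 + ω ^ 2) μ
      (1 / (c - μ) * (1 + c / ω)) (1 / (ω * (c - μ))) C := by
  have p : 0 < c - μ := by linarith
  refine ⟨(1 + c + ω) * (1 + c / ω + 1 / ω), by positivity, ?_⟩
  intro s t N F x v w hF H hx hv hf
  have hN : 0 ≤ N := (abs_nonneg _).trans hx
  have key : ∀ θ : ℝ, |Real.cos θ * (v t + c * x t) + Real.sin θ * (ω * x t)| ≤
      ((1 + c + ω) * N + F / (c - μ)) * Real.exp (-μ * (t - s)) := by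
    intro θ
    -- The phase equals `θ` at `r = t`, so `θ = 0` and `θ = π / 2` read off the two components at
    -- the final time.
    have hl : ∀ r : ℝ, HasDerivAt (fun r => ω * (r - t) + θ) ω r := fun r => by
      simpa using (((hasDerivAt_id r).sub_const t).const_mul ω).add_const θ
    have hcos := fun r => (hl r).cos
    have hsin := fun r => (hl r).sin
    have acos := absolutelyContinuousOnInterval_of_hasDerivAt s t H.le hcos (by fun_prop)
    have asin := absolutelyContinuousOnInterval_of_hasDerivAt s t H.le hsin (by fun_prop)
    have := abs_le_of_first_order (k := c) (μ := μ) (F := F) (N := (1 + c + ω) * N)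
      (y := fun r => Real.cos (ω * (r - t) + θ) * (v r + c * x r)
        + Real.sin (ω * (r - t) + θ) * (ω * x r))
      (y' := fun r => -Real.sin (ω * (r - t) + θ) * ω * (v r + c * x r)
        + Real.cos (ω * (r - t) + θ) * (w r + c * v r)
        + (Real.cos (ω * (r - t) + θ) * ω * (ω * x r)
        + Real.sin (ω * (r - t) + θ) * (ω * v r)))
      ((acos.fun_mul (H.ac.fun_add (H.ac_position.const_mul c))).fun_add
        (asin.fun_mul (H.ac_position.const_mul ω))) H.le hμ hF ?_ ?_
    · simpa using this
    · filter_upwards [hf, H.hasDerivAt_ae, H.hasDerivAt_position_ae] with r h1 h2 h3 hr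
      refine ⟨((hcos r).fun_mul ((h2 hr).fun_add ((h3 hr).const_mul c))).fun_add
        ((hsin r).fun_mul ((h3 hr).const_mul ω)), ?_⟩
      have : ∀ C S : ℝ, -S * ω * (v r + c * x r) + C * (w r + c * v r)
          + (C * ω * (ω * x r) + S * (ω * v r))
          + c * (C * (v r + c * x r) + S * (ω * x r))
          = C * (w r + 2 * c * v r + (c ^ 2 + ω ^ 2) * x r) := by intros; ring
      rw [this, abs_mul]
      calc _ ≤ 1 * |w r + 2 * c * v r + (c ^ 2 + ω ^ 2) * x r| := by
            gcongr; exact Real.abs_cos_le_one _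
        _ ≤ _ := by rw [one_mul]; exact h1 hr
    · generalize hα : ω * (s - t) + θ = φ
      calc _ ≤ |Real.cos φ * (v s + c * x s)| + |Real.sin φ * (ω * x s)| := abs_add_le _ _
        _ ≤ 1 * (|v s| + c * |x s|) + 1 * (ω * |x s|) := by
          rw [abs_mul, abs_mul]
          gcongr
          · exact Real.abs_cos_le_one _
          · refine (abs_add_le _ _).trans_eq ?_
            rw [abs_mul, abs_of_pos hc]
          · exact Real.abs_sin_le_one _
          · rw [abs_mul, abs_of_pos hω]
        _ ≤ 1 * (N + c * N) + 1 * (ω * N) := by gcongr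
        _ = _ := by ring
  have k0 := key 0
  have k1 := key (Real.pi / 2)
  simp only [Real.cos_zero, Real.sin_zero, Real.cos_pi_div_two, Real.sin_pi_div_two, one_mul,
    zero_mul, add_zero, zero_add, abs_mul, abs_of_pos hω] at k0 k1
  set E := Real.exp (-μ * (t - s)) with hE
  have hE0 : 0 < E := Real.exp_pos _
  have hX : |x t| ≤ (1 / ω) * (((1 + c + ω) * N + F / (c - μ)) * E) := by
    rw [one_div, ← div_eq_inv_mul, le_div_iff₀ hω]; linarith
  have q : 0 < 1 / ω := by positivity
  have q1 : 0 < c / ω := by positivity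
  constructor
  · have : |v t| ≤ |v t + c * x t| + c * |x t| := by
      calc |v t| = |(v t + c * x t) - c * x t| := by ring_nf
        _ ≤ |v t + c * x t| + |c * x t| := abs_sub _ _
        _ = _ := by rw [abs_mul, abs_of_pos hc]
    calc |v t| ≤ ((1 + c + ω) * N + F / (c - μ)) * E
          + c * ((1 / ω) * (((1 + c + ω) * N + F / (c - μ)) * E)) :=
          this.trans (add_le_add k0 (mul_le_mul_of_nonneg_left hX hc.le))
      _ = ((1 + c + ω) * (1 + c / ω) * N + 1 / (c - μ) * (1 + c / ω) * F) * E := by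
          field_simp
      _ ≤ _ := by
          have : (1 + c + ω) * (1 + c / ω) ≤ (1 + c + ω) * (1 + c / ω + 1 / ω) :=
            mul_le_mul_of_nonneg_left (by linarith) (by positivity)
          gcongr
  · calc |x t| ≤ ((1 + c + ω) * (1 / ω) * N + 1 / (ω * (c - μ)) * F) * E := by
          refine hX.trans_eq ?_
          field_simp
      _ ≤ _ := by gcongr; linarith

/-! ### Contraction in the weighted norm -/

/-- The weighted maximum is attained, so a pointwise estimate evaluated at `r₀` bounds the whole
weighted norm, which is finite and can be absorbed. -/
theorem exists_weighted_bound {v : ℝ → ℝ} {s t : ℝ} (hst : s ≤ t) (hv : ContinuousOn v (Icc s t))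
    (μ : ℝ) : ∃ r₀ ∈ Icc s t, ∀ r ∈ Icc s t,
      |v r| ≤ Real.exp (μ * (r₀ - s)) * |v r₀| * Real.exp (-μ * (r - s)) := by
  obtain ⟨r₀, h₀, h⟩ := isCompact_Icc.exists_isMaxOn (nonempty_Icc.2 hst)
    (f := fun r => Real.exp (μ * (r - s)) * |v r|)
    (ContinuousOn.mul (by fun_prop) hv.abs)
  refine ⟨r₀, h₀, fun r hr => ?_⟩
  have := h hr
  simp only [mem_ofPred_eq] at this
  calc |v r| = Real.exp (μ * (r - s)) * |v r| * Real.exp (-μ * (r - s)) := by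
        rw [mul_right_comm, ← Real.exp_add]; simp
    _ ≤ _ := by gcongr

/-- Contraction in the exponentially weighted norm: if the weighted gain of the delayed terms is
less than one, the solution decays exponentially. -/
theorem WeightedGain.abs_le {a b μ α β C A B δ : ℝ} (hG : WeightedGain a b μ α β C)
    (hμ : 0 < μ) (hβ : 0 ≤ β) (hC : 0 ≤ C) (hA : 0 ≤ A) (hB : 0 ≤ B)
    (hθ : Real.exp (μ * δ) * (α * A + β * B) < 1) :
    ∃ K, 0 ≤ K ∧ ∀ (p q g h : ℝ → ℝ) (s t N : ℝ) (x v w : ℝ → ℝ), IsTrajectory x v w s t →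
      (∀ r ≤ s, |x r| ≤ N) → (∀ r ≤ s, |v r| ≤ N) →
      (∀ᵐ r, r ∈ Icc s t → |p r| ≤ A ∧ |q r| ≤ B ∧
        w r + a * v r + b * x r + p r * v (g r) + q r * x (h r) = 0) →
      (∀ r ∈ Icc s t, g r ≤ r ∧ r - g r ≤ δ ∧ h r ≤ r ∧ r - h r ≤ δ) →
      |x t| ≤ K * N * Real.exp (-μ * (t - s)) := by
  set e := Real.exp (μ * δ) with he
  have he0 : 0 < e := Real.exp_pos _
  set θ := e * (α * A + β * B) with hθdef
  have h1θ : 0 < 1 - θ := by linarith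
  -- With `S = A V + B X` for the weighted maxima `V`, `X`, the gains give `S ≤ (A + B) C N + θ (S +
  -- (A + B) N)`. Solving for `S`, with `θ < 1`, bounds the input by `F ≤ e (S + (A + B) N)`, and
  -- then `x` by `C N + β F`.
  refine ⟨C + β * (e * (((A + B) * C + (A + B)) / (1 - θ) + (A + B))), by positivity, ?_⟩
  intro p q g h s t N x v w H hx hv heq hgh
  have hN : 0 ≤ N := (abs_nonneg _).trans (hx s le_rfl)
  obtain ⟨rx, hrx, hX⟩ := exists_weighted_bound H.le H.continuousOn μ
  obtain ⟨rv, hrv, hV⟩ := exists_weighted_bound H.le H.continuousOn_deriv μ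
  set X := Real.exp (μ * (rx - s)) * |x rx| with hXdef
  set V := Real.exp (μ * (rv - s)) * |v rv| with hVdef
  have hX0 : 0 ≤ X := by positivity
  have hV0 : 0 ≤ V := by positivity
  -- If `r' ≤ s` then `r - s ≤ δ`, and the factor `e` offsets the decay of the weight; otherwise the
  -- weights at `r'` and `r` differ by at most `e`.
  have hdelay : ∀ (y : ℝ → ℝ) (Y : ℝ), 0 ≤ Y → (∀ r ≤ s, |y r| ≤ N) →
      (∀ r ∈ Icc s t, |y r| ≤ Y * Real.exp (-μ * (r - s))) → ∀ r ∈ Icc s t, ∀ r' ≤ r,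
      r - r' ≤ δ → |y r'| ≤ e * (Y + N) * Real.exp (-μ * (r - s)) := by
    intro y Y hY0 hy hY r hr r' hr' hd
    rw [mul_comm e, mul_assoc, he, ← Real.exp_add]
    rcases le_or_gt r' s with hs | hs
    · calc |y r'| ≤ N := hy r' hs
        _ ≤ (Y + N) * 1 := by linarith
        _ ≤ _ := by
          gcongr
          exact Real.one_le_exp (by nlinarith)
    · calc |y r'| ≤ Y * Real.exp (-μ * (r' - s)) := hY r' ⟨hs.le, hr'.trans hr.2⟩
        _ ≤ _ := by
          gcongr
          · linarith
          · nlinarith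
  set F := e * (A * (V + N) + B * (X + N)) with hFdef
  have hF0 : 0 ≤ F := by positivity
  have hf : ∀ᵐ r, r ∈ Icc s t → |w r + a * v r + b * x r| ≤ F * Real.exp (-μ * (r - s)) := by
    filter_upwards [heq] with r hr hrm
    obtain ⟨hp, hq, e0⟩ := hr hrm
    obtain ⟨g1, g2, h1, h2⟩ := hgh r hrm
    have e1 : w r + a * v r + b * x r = -(p r * v (g r) + q r * x (h r)) := by linarith
    rw [e1, abs_neg]
    calc _ ≤ |p r| * |v (g r)| + |q r| * |x (h r)| := by
          rw [← abs_mul, ← abs_mul]; exact abs_add_le _ _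
      _ ≤ A * (e * (V + N) * Real.exp (-μ * (r - s)))
          + B * (e * (X + N) * Real.exp (-μ * (r - s))) := by
          gcongr
          · exact hdelay v V hV0 hv hV r hrm _ g1 g2
          · exact hdelay x X hX0 hx hX r hrm _ h1 h2
      _ = _ := by rw [hFdef]; ring
  have hg : ∀ r ∈ Icc s t, |v r| ≤ (C * N + α * F) * Real.exp (-μ * (r - s)) ∧
      |x r| ≤ (C * N + β * F) * Real.exp (-μ * (r - s)) := by
    intro r hr
    refine hG s r N F x v w hF0 (H.mono le_rfl hr.1 hr.2) (hx s le_rfl) (hv s le_rfl) ?_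
    filter_upwards [hf] with r' h' hr'
    exact h' (Icc_subset_Icc le_rfl hr.2 hr')
  have hweight : ∀ r D z : ℝ, z ≤ D * Real.exp (-μ * (r - s)) →
      Real.exp (μ * (r - s)) * z ≤ D := by
    intro r D z hz
    calc _ ≤ Real.exp (μ * (r - s)) * (D * Real.exp (-μ * (r - s))) := by gcongr
      _ = D := by rw [mul_left_comm, ← Real.exp_add]; simp
  have hVle : V ≤ C * N + α * F := hweight _ _ _ (hg rv hrv).1
  have hXle : X ≤ C * N + β * F := hweight _ _ _ (hg rx hrx).2
  have hS : A * V + B * X ≤ (((A + B) * C + (A + B)) / (1 - θ)) * N := by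
    rw [div_mul_eq_mul_div, le_div_iff₀ h1θ]
    have h1 : A * V + B * X ≤ (A + B) * C * N + θ * ((A * V + B * X) + (A + B) * N) := by
      calc A * V + B * X ≤ A * (C * N + α * F) + B * (C * N + β * F) := by gcongr
        _ = _ := by rw [hFdef, hθdef]; ring
    have h2 : θ * ((A + B) * N) ≤ 1 * ((A + B) * N) := by gcongr
    linarith
  refine (hg t ⟨H.le, le_rfl⟩).2.trans ?_
  have hF1 : F ≤ e * ((((A + B) * C + (A + B)) / (1 - θ)) * N + (A + B) * N) := by
    exact mul_le_mul_of_nonneg_left (by linarith) he0.le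
  gcongr
  calc C * N + β * F
      ≤ C * N + β * (e * ((((A + B) * C + (A + B)) / (1 - θ)) * N + (A + B) * N)) := by gcongr
    _ = _ := by ring

/-! ### Growth bound on bounded time stretches -/

/-- A priori exponential growth bound for a second order equation with bounded coefficients and
arbitrary delays. -/
theorem IsTrajectory.abs_le_exp {a b A B : ℝ} (ha : 0 ≤ a) (hb : 0 ≤ b) (hA : 0 ≤ A) (hB : 0 ≤ B)
    {p q g h x v w : ℝ → ℝ} {s t N : ℝ} (H : IsTrajectory x v w s t)
    (hx : ∀ r ≤ s, |x r| ≤ N) (hv : ∀ r ≤ s, |v r| ≤ N)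
    (heq : ∀ᵐ r, r ∈ Icc s t → |p r| ≤ A ∧ |q r| ≤ B ∧
        w r + a * v r + b * x r + p r * v (g r) + q r * x (h r) = 0)
    (hgh : ∀ r ∈ Icc s t, g r ≤ r ∧ h r ≤ r) :
    |x t| ≤ 3 * N * Real.exp (2 * (1 + a + b + A + B) * (t - s)) ∧
    |v t| ≤ 3 * N * Real.exp (2 * (1 + a + b + A + B) * (t - s)) := by
  have hN : 0 ≤ N := (abs_nonneg _).trans (hx s le_rfl)
  set c := 1 + a + b + A + B with hc
  have hc0 : 0 < c := by positivity
  -- Derivatives are at most `c (N + Q)` in the weight `exp (2 c (r - s))`, and integration divides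
  -- by `2 c`. Hence `Q ≤ N + (N + Q) / 2`, that is, `Q ≤ 3 N`.
  obtain ⟨rx, hrx, hX⟩ := exists_weighted_bound H.le H.continuousOn (-(2 * c))
  obtain ⟨rv, hrv, hV⟩ := exists_weighted_bound H.le H.continuousOn_deriv (-(2 * c))
  simp only [neg_neg] at hX hV
  set X := Real.exp (-(2 * c) * (rx - s)) * |x rx| with hXdef
  set V := Real.exp (-(2 * c) * (rv - s)) * |v rv| with hVdef
  have hX0 : 0 ≤ X := by positivity
  have hV0 : 0 ≤ V := by positivity
  set Q := max X V with hQ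
  have hQ0 : 0 ≤ Q := hX0.trans (le_max_left _ _)
  have hpast : ∀ (y : ℝ → ℝ) (Y : ℝ), Y ≤ Q → (∀ r ≤ s, |y r| ≤ N) →
      (∀ r ∈ Icc s t, |y r| ≤ Y * Real.exp (2 * c * (r - s))) → ∀ r ∈ Icc s t, ∀ r' ≤ r,
      |y r'| ≤ (N + Q) * Real.exp (2 * c * (r - s)) := by
    intro y Y hYQ hy hY r hr r' hr'
    rcases le_or_gt r' s with hs | hs
    · calc |y r'| ≤ N := hy r' hs
        _ ≤ (N + Q) * 1 := by linarith
        _ ≤ _ := by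
          gcongr
          exact Real.one_le_exp (mul_nonneg (by positivity) (by linarith [hr.1]))
    · calc |y r'| ≤ Y * Real.exp (2 * c * (r' - s)) := hY r' ⟨hs.le, hr'.trans hr.2⟩
        _ ≤ _ := by
          gcongr
          linarith
  have px := hpast x X (le_max_left _ _) hx hX
  have pv := hpast v V (le_max_right _ _) hv hV
  have hw : ∀ᵐ r, r ∈ Icc s t → |w r| ≤ c * (N + Q) * Real.exp (2 * c * (r - s)) := by
    filter_upwards [heq] with r hr hrm
    obtain ⟨hp, hq, e0⟩ := hr hrm
    obtain ⟨g1, h1⟩ := hgh r hrm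
    set E := (N + Q) * Real.exp (2 * c * (r - s)) with hE
    have hE0 : 0 ≤ E := by positivity
    have e1 : w r = -((a * v r + b * x r) + (p r * v (g r) + q r * x (h r))) := by linarith
    rw [e1, abs_neg]
    calc _ ≤ (|a * v r| + |b * x r|) + (|p r * v (g r)| + |q r * x (h r)|) :=
          (abs_add_le _ _).trans (add_le_add (abs_add_le _ _) (abs_add_le _ _))
      _ = (a * |v r| + b * |x r|) + (|p r| * |v (g r)| + |q r| * |x (h r)|) := by
          simp only [abs_mul, abs_of_nonneg ha, abs_of_nonneg hb]
      _ ≤ (a * E + b * E) + (A * E + B * E) := by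
          gcongr
          · exact pv r hrm r le_rfl
          · exact px r hrm r le_rfl
          · exact pv r hrm _ g1
          · exact px r hrm _ h1
      _ ≤ c * E := by rw [hc]; linarith
      _ = _ := by rw [hE]; ring
  have step : ∀ (y y' : ℝ → ℝ), AbsolutelyContinuousOnInterval y s t → |y s| ≤ N →
      (∀ᵐ r, r ∈ Icc s t → HasDerivAt y (y' r) r) →
      (∀ᵐ r, r ∈ Icc s t → |y' r| ≤ c * (N + Q) * Real.exp (2 * c * (r - s))) →
      ∀ r ∈ Icc s t, |y r| ≤ (N + (N + Q) / 2) * Real.exp (2 * c * (r - s)) := by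
    intro y y' hac hys hd hb' r hr
    have hac' : AbsolutelyContinuousOnInterval y s r := hac.mono (by
      rw [uIcc_of_le hr.1, uIcc_of_le H.le]; exact Icc_subset_Icc le_rfl hr.2)
    have h1 := hac'.abs_le_of_abs_deriv_le hr.1 (κ := 2 * c) (F := c * (N + Q)) (by positivity)
      (by positivity) (by
        filter_upwards [hd, hb'] with z h1 h2 hz
        have hz' : z ∈ Icc s t := Icc_subset_Icc le_rfl hr.2 hz
        rw [(h1 hz').deriv]; exact h2 hz')
    have h2 : c * (N + Q) / (2 * c) = (N + Q) / 2 := by field_simp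
    rw [h2] at h1
    have h3 : 1 ≤ Real.exp (2 * c * (r - s)) :=
      Real.one_le_exp (mul_nonneg (by positivity) (by linarith [hr.1]))
    nlinarith
  have sx := step x v H.ac_position (hx s le_rfl) H.hasDerivAt_position_ae (by
    refine Eventually.of_forall fun r hr => (pv r hr r le_rfl).trans ?_
    have : N + Q ≤ c * (N + Q) := by
      have : 1 ≤ c := by linarith
      nlinarith
    gcongr)
  have sv := step v w H.ac (hv s le_rfl) H.hasDerivAt_ae hw
  have hweight : ∀ r D z : ℝ, z ≤ D * Real.exp (2 * c * (r - s)) →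
      Real.exp (-(2 * c) * (r - s)) * z ≤ D := by
    intro r D z hz
    calc _ ≤ Real.exp (-(2 * c) * (r - s)) * (D * Real.exp (2 * c * (r - s))) := by gcongr
      _ = D := by rw [mul_left_comm, ← Real.exp_add]; simp
  have hQN : Q ≤ 3 * N := by
    have : Q ≤ N + (N + Q) / 2 :=
      max_le (hweight _ _ _ (sx rx hrx)) (hweight _ _ _ (sv rv hrv))
    linarith
  have ht : t ∈ Icc s t := ⟨H.le, le_rfl⟩
  have h3 : N + (N + Q) / 2 ≤ 3 * N := by linarith
  exact ⟨(sx t ht).trans (by gcongr), (sv t ht).trans (by gcongr)⟩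

/-! ### From gains to exponential stability -/

theorem IsSolution.isTrajectory {a b a₁ b₁ g h : ℝ → ℝ} {s : ℝ} {φ ψ : ℝ → ℝ} {x₀ x₀' : ℝ}
    {x v : ℝ → ℝ} (H : IsSolution a b a₁ b₁ g h s φ ψ x₀ x₀' x v) {t : ℝ} (hst : s ≤ t) :
    IsTrajectory x v (deriv v) s t where
  le := hst
  hasDeriv r hr := (H.hasDeriv r hr.1).mono Icc_subset_Ici_self
  ac := H.locally_ac t hst
  hasDerivAt_ae := by
    have := (ae_restrict_iff' measurableSet_Ici).1 H.equation
    filter_upwards [this] with r hr hrm using (hr hrm.1).1.hasDerivAt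

theorem IsInitialFunction.abs_add_abs_le_iSup {s : ℝ} {φ ψ : ℝ → ℝ} (hφ : IsInitialFunction s φ)
    (hψ : IsInitialFunction s ψ) {r : ℝ} (hr : r < s) :
    |φ r| + |ψ r| ≤ ⨆ q : Iio s, (|φ q| + |ψ q|) := by
  obtain ⟨C, hC⟩ := hφ.bounded
  obtain ⟨D, hD⟩ := hψ.bounded
  refine le_ciSup (f := fun q : Iio s => |φ q| + |ψ q|) ⟨C + D, ?_⟩ ⟨r, hr⟩
  rintro _ ⟨q, rfl⟩
  exact add_le_add (hC q q.2) (hD q q.2)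

theorem IsDelayedArgument.exists_delay {g : ℝ → ℝ} (hg : IsDelayedArgument g) :
    ∃ T δ : ℝ, ∀ t, T ≤ t → t - g t ≤ δ := by
  obtain ⟨δ, hδ⟩ := hg.bounded_delay
  obtain ⟨T, hT⟩ := eventually_atTop.1 (eventually_map.1 hδ)
  exact ⟨T, δ, hT⟩

/-- A small gain condition at weight zero, with gains depending continuously on the weight,
implies exponential stability. -/
theorem exponentiallyStable_of_weightedGain {a b : ℝ} (ha : 0 ≤ a) (hb : 0 ≤ b)
    {a₁ b₁ g h : ℝ → ℝ}
    (ha₁ : MemLp a₁ ∞ (volume.restrict (Ici (0 : ℝ))))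
    (hb₁ : MemLp b₁ ∞ (volume.restrict (Ici (0 : ℝ))))
    (hg : IsDelayedArgument g) (hh : IsDelayedArgument h) {t₀ : ℝ} (ht₀ : 0 ≤ t₀)
    {α β : ℝ → ℝ} {m : ℝ} (hm : 0 < m) (hαc : ContinuousAt α 0) (hβc : ContinuousAt β 0)
    (hG : ∀ μ, 0 < μ → μ < m →
      0 ≤ β μ ∧ ∃ C, 0 ≤ C ∧ WeightedGain a b μ (α μ) (β μ) C)
    (hcond : α 0 * lpNorm a₁ ∞ (volume.restrict (Ici t₀)) +
      β 0 * lpNorm b₁ ∞ (volume.restrict (Ici t₀)) < 1) :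
    ExponentiallyStable (fun _ => a) (fun _ => b) a₁ b₁ g h := by
  set A := lpNorm a₁ ∞ (volume.restrict (Ici t₀)) with hA
  set B := lpNorm b₁ ∞ (volume.restrict (Ici t₀)) with hB
  set A' := lpNorm a₁ ∞ (volume.restrict (Ici (0 : ℝ))) with hA'
  set B' := lpNorm b₁ ∞ (volume.restrict (Ici (0 : ℝ))) with hB'
  have hsub : Ici t₀ ⊆ Ici (0 : ℝ) := Ici_subset_Ici.2 ht₀
  have bound : ∀ {f : ℝ → ℝ} {T : ℝ}, MemLp f ∞ (volume.restrict (Ici T)) →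
      ∀ᵐ r, r ∈ Ici T → |f r| ≤ lpNorm f ∞ (volume.restrict (Ici T)) := fun hf =>
    (ae_restrict_iff' measurableSet_Ici).1 (ae_le_lpNorm_exponent_top hf)
  have bA' := bound ha₁
  have bB' := bound hb₁
  have bA := bound (ha₁.mono_measure (Measure.restrict_mono hsub le_rfl))
  have bB := bound (hb₁.mono_measure (Measure.restrict_mono hsub le_rfl))
  obtain ⟨Tg, δg, hTg⟩ := hg.exists_delay
  obtain ⟨Th, δh, hTh⟩ := hh.exists_delay
  set δ := max δg δh
  set T := max t₀ (max Tg Th) with hT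
  have hTt₀ : t₀ ≤ T := le_max_left _ _
  have hT0 : 0 ≤ T := ht₀.trans hTt₀
  obtain ⟨μ, hμ0, hμm, hμ⟩ : ∃ μ, 0 < μ ∧ μ < m ∧
      Real.exp (μ * δ) * (α μ * A + β μ * B) < 1 := by
    have hc : ContinuousAt (fun μ => Real.exp (μ * δ) * (α μ * A + β μ * B)) 0 := by fun_prop
    have h1 := hc.tendsto.eventually_lt_const (u := 1) (by simpa using hcond)
    have h2 : ∀ᶠ μ in nhdsWithin (0 : ℝ) (Ioi 0), 0 < μ ∧ μ < m := Ioo_mem_nhdsGT hm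
    obtain ⟨μ, h3, h4, h5⟩ := ((h1.filter_mono nhdsWithin_le_nhds).and h2).exists
    exact ⟨μ, h4, h5, h3⟩
  obtain ⟨hβ, C, hC, hgain⟩ := hG μ hμ0 hμm
  obtain ⟨K, hK0, hK⟩ := hgain.abs_le hμ0 hβ hC lpNorm_nonneg lpNorm_nonneg hμ
  -- The growth bound uses norms over `[0, ∞)`, since the initial point may precede `t₀`.
  set L := 3 * Real.exp (2 * (1 + a + b + A' + B') * T) with hL
  have hA0 : 0 ≤ A' := lpNorm_nonneg
  have hB0 : 0 ≤ B' := lpNorm_nonneg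
  have hL3 : 3 ≤ L := by
    have : 1 ≤ Real.exp (2 * (1 + a + b + A' + B') * T) := Real.one_le_exp (by positivity)
    linarith
  -- The contraction starts at `τ = max s T`, where `τ - s ≤ T`; the factor `exp (μ T)` pays for
  -- this late start. All values up to `τ`, the initial functions included, serve as history bounded
  -- by `L * N`.
  refine ⟨(1 + K) * L * Real.exp (μ * T), μ, by positivity, hμ0, ?_⟩
  intro s hs φ ψ hφ hψ x₀ x₀' x v H t hst
  set N := |x₀| + |x₀'| + ⨆ q : Iio s, (|φ q| + |ψ q|) with hN
  have hsup : 0 ≤ ⨆ q : Iio s, (|φ q| + |ψ q|) := Real.iSup_nonneg fun q => by positivity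
  have hN0 : 0 ≤ N := by positivity
  have hxN : ∀ r ≤ s, |x r| ≤ N := by
    intro r hr
    rcases hr.lt_or_eq with hr | rfl
    · rw [H.history r hr]
      have := hφ.abs_add_abs_le_iSup hψ hr
      linarith [abs_nonneg x₀, abs_nonneg x₀', abs_nonneg (ψ r)]
    · rw [H.initial]; linarith [abs_nonneg x₀']
  have hvN : ∀ r ≤ s, |v r| ≤ N := by
    intro r hr
    rcases hr.lt_or_eq with hr | rfl
    · rw [H.history_deriv r hr]
      have := hφ.abs_add_abs_le_iSup hψ hr
      linarith [abs_nonneg x₀, abs_nonneg x₀', abs_nonneg (φ r)]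
    · rw [H.initial_deriv]; linarith [abs_nonneg x₀]
  have heq := (ae_restrict_iff' measurableSet_Ici).1 H.equation
  set τ := max s T with hτ
  have hsτ : s ≤ τ := le_max_left _ _
  have hTτ : T ≤ τ := le_max_right _ _
  have hτT : τ - s ≤ T := by
    rw [sub_le_iff_le_add]
    exact max_le (by linarith) (by linarith)
  have hgrow : ∀ r ≤ τ, |x r| ≤ L * N ∧ |v r| ≤ L * N := by
    intro r hr
    rcases le_or_gt r s with hrs | hrs
    · have : N ≤ L * N := by nlinarith
      exact ⟨(hxN r hrs).trans this, (hvN r hrs).trans this⟩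
    · have h1 := (H.isTrajectory hrs.le).abs_le_exp ha hb hA0 hB0 hxN hvN (p := a₁) (q := b₁)
        (g := g) (h := h) (by
          filter_upwards [heq, bA', bB'] with z h1 h2 h3 hz
          exact ⟨h2 (hs.trans hz.1), h3 (hs.trans hz.1), (h1 hz.1).2⟩)
        (fun z hz => ⟨hg.le_self z (hs.trans hz.1), hh.le_self z (hs.trans hz.1)⟩)
      have h2 : 3 * N * Real.exp (2 * (1 + a + b + A' + B') * (r - s)) ≤ L * N := by
        rw [hL, mul_right_comm]
        gcongr
        linarith
      exact ⟨h1.1.trans h2, h1.2.trans h2⟩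
  rcases le_total t τ with htτ | htτ
  · have h1 : 1 ≤ Real.exp (μ * T) * Real.exp (-μ * (t - s)) := by
      rw [← Real.exp_add]
      exact Real.one_le_exp (by nlinarith)
    calc |x t| ≤ L * N * 1 := by rw [mul_one]; exact (hgrow t htτ).1
      _ ≤ (1 + K) * L * N * (Real.exp (μ * T) * Real.exp (-μ * (t - s))) := by
        gcongr
        nlinarith
      _ = _ := by ring
  · have h1 := hK a₁ b₁ g h τ t (L * N) x v (deriv v) ((H.isTrajectory hst).mono hsτ htτ le_rfl)
      (fun r hr => (hgrow r hr).1) (fun r hr => (hgrow r hr).2) (by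
        filter_upwards [heq, bA, bB] with z h1 h2 h3 hz
        have hz' : t₀ ≤ z := (hTt₀.trans hTτ).trans hz.1
        exact ⟨h2 hz', h3 hz', (h1 (hsτ.trans hz.1)).2⟩)
      (fun z hz => by
        have hTz : T ≤ z := hTτ.trans hz.1
        have hz0 : 0 ≤ z := hT0.trans hTz
        have hTgh : max Tg Th ≤ z := (le_max_right _ _).trans hTz
        exact ⟨hg.le_self z hz0, (hTg z ((le_max_left _ _).trans hTgh)).trans (le_max_left _ _),
          hh.le_self z hz0, (hTh z ((le_max_right _ _).trans hTgh)).trans (le_max_right _ _)⟩)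
    have h2 : Real.exp (-μ * (t - τ)) ≤ Real.exp (μ * T) * Real.exp (-μ * (t - s)) := by
      rw [← Real.exp_add]
      exact Real.exp_le_exp.2 (by nlinarith)
    calc |x t| ≤ K * (L * N) * Real.exp (-μ * (t - τ)) := h1
      _ ≤ (1 + K) * (L * N) * (Real.exp (μ * T) * Real.exp (-μ * (t - s))) := by
        gcongr
        linarith
      _ = _ := by ring

/-! ### The three explicit criteria -/

/-- Small gain criterion when the characteristic roots `-k₁`, `-k₂` are real. -/
theorem exponentiallyStable_of_real_roots {k₁ k₂ : ℝ} (hk₁ : 0 < k₁) (hk₂ : 0 < k₂)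
    {a₁ b₁ g h : ℝ → ℝ}
    (ha₁ : MemLp a₁ ∞ (volume.restrict (Ici (0 : ℝ))))
    (hb₁ : MemLp b₁ ∞ (volume.restrict (Ici (0 : ℝ))))
    (hg : IsDelayedArgument g) (hh : IsDelayedArgument h) {t₀ : ℝ} (ht₀ : 0 ≤ t₀)
    (hcond : 2 / k₁ * lpNorm a₁ ∞ (volume.restrict (Ici t₀)) +
      1 / (k₁ * k₂) * lpNorm b₁ ∞ (volume.restrict (Ici t₀)) < 1) :
    ExponentiallyStable (fun _ => k₁ + k₂) (fun _ => k₁ * k₂) a₁ b₁ g h := by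
  refine exponentiallyStable_of_weightedGain (by positivity) (by positivity) ha₁ hb₁ hg hh ht₀
    (α := fun μ => 1 / (k₁ - μ) + k₂ * (1 / ((k₁ - μ) * (k₂ - μ))))
    (β := fun μ => 1 / ((k₁ - μ) * (k₂ - μ))) (lt_min hk₁ hk₂) ?_ ?_ ?_ ?_
  · fun_prop (disch := simp [hk₁.ne', hk₂.ne'])
  · fun_prop (disch := simp [hk₁.ne', hk₂.ne'])
  · intro μ _ hμ
    have h₁ : μ < k₁ := hμ.trans_le (min_le_left _ _)
    have h₂ : μ < k₂ := hμ.trans_le (min_le_right _ _)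
    have p₁ : 0 < k₁ - μ := by linarith
    have p₂ : 0 < k₂ - μ := by linarith
    exact ⟨by positivity, weightedGain_real_roots hk₂ h₁ h₂⟩
  · have e : 1 / k₁ + k₂ * (1 / (k₁ * k₂)) = 2 / k₁ := by field_simp; norm_num
    simpa only [sub_zero, e] using hcond

/-- Small gain criterion when the characteristic roots are `-c ± ω i`. -/
theorem exponentiallyStable_of_complex_roots {c ω : ℝ} (hc : 0 < c) (hω : 0 < ω)
    {a₁ b₁ g h : ℝ → ℝ}
    (ha₁ : MemLp a₁ ∞ (volume.restrict (Ici (0 : ℝ))))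
    (hb₁ : MemLp b₁ ∞ (volume.restrict (Ici (0 : ℝ))))
    (hg : IsDelayedArgument g) (hh : IsDelayedArgument h) {t₀ : ℝ} (ht₀ : 0 ≤ t₀)
    (hcond : 1 / c * (1 + c / ω) * lpNorm a₁ ∞ (volume.restrict (Ici t₀)) +
      1 / (ω * c) * lpNorm b₁ ∞ (volume.restrict (Ici t₀)) < 1) :
    ExponentiallyStable (fun _ => 2 * c) (fun _ => c ^ 2 + ω ^ 2) a₁ b₁ g h := by
  refine exponentiallyStable_of_weightedGain (by positivity) (by positivity) ha₁ hb₁ hg hh ht₀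
    (α := fun μ => 1 / (c - μ) * (1 + c / ω))
    (β := fun μ => 1 / (ω * (c - μ))) hc ?_ ?_ ?_ ?_
  · fun_prop (disch := simp [hc.ne'])
  · fun_prop (disch := simp [hc.ne', hω.ne'])
  · intro μ _ hμ
    have p : 0 < c - μ := by linarith
    exact ⟨by positivity, weightedGain_complex_roots hc hω hμ⟩
  · simpa only [sub_zero] using hcond

theorem corollary1 (a b : ℝ) (ha : 0 < a) (hb : 0 < b) (a₁ b₁ g h : ℝ → ℝ)
    (ha₁ : MemLp a₁ ∞ (volume.restrict (Ici (0 : ℝ))))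
    (hb₁ : MemLp b₁ ∞ (volume.restrict (Ici (0 : ℝ))))
    (hg : IsDelayedArgument g) (hh : IsDelayedArgument h)
    (t₀ : ℝ) (ht₀ : 0 ≤ t₀)
    (hcond :
      (4 * b < a ^ 2 ∧
        2 * a / (√(a ^ 2 - 4 * b) * (a - √(a ^ 2 - 4 * b))) *
            lpNorm a₁ ∞ (volume.restrict (Ici t₀)) +
          1 / b * lpNorm b₁ ∞ (volume.restrict (Ici t₀)) < 1) ∨
      (a ^ 2 < 4 * b ∧
        2 * (a + √(4 * b - a ^ 2)) / (a * √(4 * b - a ^ 2)) *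
            lpNorm a₁ ∞ (volume.restrict (Ici t₀)) +
          4 / (a * √(4 * b - a ^ 2)) * lpNorm b₁ ∞ (volume.restrict (Ici t₀)) < 1) ∨
      (a ^ 2 = 4 * b ∧
        2 / √b * lpNorm a₁ ∞ (volume.restrict (Ici t₀)) +
          1 / b * lpNorm b₁ ∞ (volume.restrict (Ici t₀)) < 1)) :
    ExponentiallyStable (fun _ => a) (fun _ => b) a₁ b₁ g h := by
  rcases hcond with ⟨hD, hc⟩ | ⟨hD, hc⟩ | ⟨hD, hc⟩
  · set d := √(a ^ 2 - 4 * b) with hd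
    have hd0 : 0 < d := Real.sqrt_pos.2 (by linarith)
    have hd2 : d ^ 2 = a ^ 2 - 4 * b := Real.sq_sqrt (by linarith)
    have hda : d < a := by nlinarith
    have e1 : a = (a + d) / 2 + (a - d) / 2 := by ring
    have e2 : b = (a + d) / 2 * ((a - d) / 2) := by linarith
    -- The gain `2 / k₁` is not symmetric in the roots, so `k₁` is the larger one.
    have key := exponentiallyStable_of_real_roots (k₁ := (a + d) / 2) (k₂ := (a - d) / 2)
      (by linarith) (by linarith) ha₁ hb₁ hg hh ht₀
    rw [← e1, ← e2] at key
    refine key (lt_of_le_of_lt ?_ hc)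
    -- The gain obtained, `4 / (a + d)`, is no larger than the coefficient in the hypothesis:
    -- cross-multiplied, the claim is `0 ≤ 2 a² - 2 a d + 4 d²`.
    have hle : 2 / ((a + d) / 2) ≤ 2 * a / (d * (a - d)) := by
      have : 0 < a - d := by linarith
      rw [div_le_div_iff₀ (by positivity) (by positivity)]
      nlinarith [sq_nonneg (a - d), mul_pos hd0 ha, sq_nonneg d]
    have := lpNorm_nonneg (f := a₁) (p := ∞) (μ := volume.restrict (Ici t₀))
    gcongr
  · set d := √(4 * b - a ^ 2) with hd
    have hd0 : 0 < d := Real.sqrt_pos.2 (by linarith)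
    have hd2 : d ^ 2 = 4 * b - a ^ 2 := Real.sq_sqrt (by linarith)
    have e1 : 2 * (a / 2) = a := by ring
    have e2 : (a / 2) ^ 2 + (d / 2) ^ 2 = b := by linarith
    have key := exponentiallyStable_of_complex_roots (c := a / 2) (ω := d / 2)
      (by positivity) (by positivity) ha₁ hb₁ hg hh ht₀
    rw [e1, e2] at key
    refine key ?_
    have e3 : 1 / (a / 2) * (1 + a / 2 / (d / 2)) = 2 * (a + d) / (a * d) := by
      field_simp; ring
    have e4 : 1 / (d / 2 * (a / 2)) = 4 / (a * d) := by field_simp; norm_num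
    rwa [e3, e4]
  · have hs : √b = a / 2 := by
      rw [Real.sqrt_eq_iff_mul_self_eq hb.le (by positivity)]; linarith
    have e1 : a / 2 + a / 2 = a := by ring
    have e2 : a / 2 * (a / 2) = b := by linarith
    have key := exponentiallyStable_of_real_roots (k₁ := a / 2) (k₂ := a / 2)
      (by positivity) (by positivity) ha₁ hb₁ hg hh ht₀
    rw [e1, e2, ← hs] at key
    exact key hc
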